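/- Let $\Omega\subseteq\mathbb{R}^d$ be open, let $\rho:\Omega\to\mathbb{R}_{>0}$ be Lipschitz, let $\alpha,\beta,\gamma\in\mathbb{R}$ satisfy $\alpha=\beta-1=\gamma-2$, and assume $\int_\Omega\rho^\alpha\,dx<\infty$. For measurable $A\subseteq\Omega$ put $|A|_\alpha=\int_A\rho^\alpha\,dx$ and let $$|\partial A|_\beta=\int_\Omega\rho^\beta|\nabla 1_A|=\sup\Big\{\int_A\operatorname{div}\varphi\,dx:\ \varphi\in C_c^\infty(\Omega;\mathbb{R}^d),\ |\varphi|\le\rho^\beta\Big\}\in[0,\infty]$$ be the $\rho^\beta$-weighted perimeter of $A$ in $\Omega$ (the $(d-1)$-dimensional integral of $\rho^\beta$ over the cut). If $|A|_\alpha>0$ and $|\Omega\setminus A|_\alpha>0$, the $(\alpha,\beta)$-sparsity of the cut defined by $A$ is $$\Phi(A)=\frac{|\partial A|_\beta}{\min(|A|_\alpha,|\Omega\setminus A|_\alpha)}.$$ For a weakly differentiable $w:\Omega\to\mathbb{R}$ with $\int_\Omega\rho^\gamma|\nabla w|^2\,dx<\infty$ and $0<\int_\Omega\rho^\alpha w^2\,dx<\infty$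 let $$R_{\alpha,\gamma}(w)=\frac{\int_\Omega\rho^\gamma|\nabla w|^2\,dx}{\int_\Omega\rho^\alpha w^2\,dx},$$ let $\lambda_2$ be the infimum of $R_{\alpha,\gamma}(w)$ over all such $w$ with $\int_\Omega\rho^\alpha w\,dx=0$, and call $u$ an $(\alpha,\gamma)$-principal eigenfunction if it is such a function with $\int_\Omega\rho^\alpha u\,dx=0$ and $R_{\alpha,\gamma}(u)=\lambda_2$. Let $u$ be an $(\alpha,\gamma)$-principal eigenfunction, and let $\Phi_{(\alpha,\beta,\gamma)}=\inf_t\Phi(\{u>t\})$ be the $(\alpha,\beta)$-sparsity of the $(\alpha,\gamma)$-spectral sweep cut defined by $u$, where $t$ ranges over the real numbers for which both sides of the cut have positive $\alpha$-mass. Then $$\Phi_{(\alpha,\beta,\gamma)}^2\le 4\lambda_2 .$$ -/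

import Mathlib

open MeasureTheory Set
open scoped ENNReal NNReal ContDiff

noncomputable section

/-- `G` is a weak (distributional) gradient of `u` on the open set `Ω ⊆ ℝ^d`: both are locally
integrable on `Ω`, and `∫_Ω u ∂_v φ = - ∫_Ω ⟪G, v⟫ φ` for all `φ ∈ C_c^∞(Ω)` and all directions
`v`. -/
structure HasWeakGradientOn {d : ℕ} (Ω : Set (EuclideanSpace ℝ (Fin d)))
    (u : EuclideanSpace ℝ (Fin d) → ℝ)
    (G : EuclideanSpace ℝ (Fin d) → EuclideanSpace ℝ (Fin d)) : Prop where
  locallyIntegrable : LocallyIntegrableOn u Ω volume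
  locallyIntegrable_grad : LocallyIntegrableOn G Ω volume
  integral_eq : ∀ φ : EuclideanSpace ℝ (Fin d) → ℝ, ContDiff ℝ ∞ φ → HasCompactSupport φ →
    tsupport φ ⊆ Ω → ∀ v : EuclideanSpace ℝ (Fin d),
      ∫ x in Ω, u x * fderiv ℝ φ x v = - ∫ x in Ω, inner ℝ (G x) v * φ x

/-- The weighted mass `|A|_α = ∫_{A ∩ Ω} ρ^α dx`. -/
def weightedMass {d : ℕ} (Ω : Set (EuclideanSpace ℝ (Fin d))) (ρ : EuclideanSpace ℝ (Fin d) → ℝ)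
    (α : ℝ) (A : Set (EuclideanSpace ℝ (Fin d))) : ℝ≥0∞ :=
  ∫⁻ x in A ∩ Ω, ENNReal.ofReal (ρ x ^ α)

/-- The divergence of a differentiable vector field on `ℝ^d`. -/
def vectorDivergence {d : ℕ} (φ : EuclideanSpace ℝ (Fin d) → EuclideanSpace ℝ (Fin d))
    (x : EuclideanSpace ℝ (Fin d)) : ℝ :=
  ∑ i, fderiv ℝ φ x (EuclideanSpace.single i 1) i

/-- The weighted perimeter `|∂A|_β = ∫_Ω ρ^β |∇ 1_A|` of `A` in `Ω` (De Giorgi): the total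
variation over `Ω`, with weight `ρ^β`, of the distributional gradient of the indicator of `A`,
i.e. the supremum of `∫_{A ∩ Ω} div φ` over `φ ∈ C_c^∞(Ω; ℝ^d)` with `|φ| ≤ ρ^β` on `Ω`. It is the
`(d-1)`-dimensional integral of `ρ^β` over the (reduced) boundary of `A` inside `Ω`. -/
def weightedPerimeter {d : ℕ} (Ω : Set (EuclideanSpace ℝ (Fin d)))
    (ρ : EuclideanSpace ℝ (Fin d) → ℝ) (β : ℝ) (A : Set (EuclideanSpace ℝ (Fin d))) : ℝ≥0∞ :=
  ⨆ (φ : EuclideanSpace ℝ (Fin d) → EuclideanSpace ℝ (Fin d)) (_ : ContDiff ℝ ∞ φ)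
    (_ : HasCompactSupport φ) (_ : tsupport φ ⊆ Ω) (_ : ∀ x ∈ Ω, ‖φ x‖ ≤ ρ x ^ β),
    ENNReal.ofReal (∫ x in A ∩ Ω, vectorDivergence φ x)

/-- The `(α, β)`-sparsity of the cut of `Ω` into `A ∩ Ω` and `Ω \ A`: the weighted perimeter
divided by the smaller of the two weighted masses. It is used only for genuine cuts, where both
masses are positive. -/
def cutSparsity {d : ℕ} (Ω : Set (EuclideanSpace ℝ (Fin d))) (ρ : EuclideanSpace ℝ (Fin d) → ℝ)
    (α β : ℝ) (A : Set (EuclideanSpace ℝ (Fin d))) : ℝ≥0∞ :=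
  weightedPerimeter Ω ρ β A / min (weightedMass Ω ρ α A) (weightedMass Ω ρ α Aᶜ)

/-- The `(α, β)`-sparsity of the sweep cut of `u`: the infimum of the sparsities of the
superlevel sets `C_t = {u > t}`, over those `t ∈ ℝ` for which both sides of the cut have positive
mass. -/
def sweepCutSparsity {d : ℕ} (Ω : Set (EuclideanSpace ℝ (Fin d)))
    (ρ : EuclideanSpace ℝ (Fin d) → ℝ) (α β : ℝ) (u : EuclideanSpace ℝ (Fin d) → ℝ) : ℝ≥0∞ :=
  ⨅ (t : ℝ) (_ : weightedMass Ω ρ α {x | t < u x} ≠ 0)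
    (_ : weightedMass Ω ρ α {x | t < u x}ᶜ ≠ 0), cutSparsity Ω ρ α β {x | t < u x}

/-- The `(α, γ)`-Rayleigh quotient of a function `u` with weak gradient `G`. -/
def rayleighQuotient {d : ℕ} (Ω : Set (EuclideanSpace ℝ (Fin d)))
    (ρ : EuclideanSpace ℝ (Fin d) → ℝ) (α γ : ℝ) (u : EuclideanSpace ℝ (Fin d) → ℝ)
    (G : EuclideanSpace ℝ (Fin d) → EuclideanSpace ℝ (Fin d)) : ℝ≥0∞ :=
  (∫⁻ x in Ω, ENNReal.ofReal (ρ x ^ γ) * ‖G x‖ₑ ^ 2) /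
    (∫⁻ x in Ω, ENNReal.ofReal (ρ x ^ α) * ‖u x‖ₑ ^ 2)

/-- `u`, with weak gradient `G`, is a competitor for the principal eigenvalue: both integrals in
the Rayleigh quotient are finite, `u` is not a.e. zero, and `∫_Ω ρ^α u = 0`. -/
structure IsRayleighCompetitor {d : ℕ} (Ω : Set (EuclideanSpace ℝ (Fin d)))
    (ρ : EuclideanSpace ℝ (Fin d) → ℝ) (α γ : ℝ) (u : EuclideanSpace ℝ (Fin d) → ℝ)
    (G : EuclideanSpace ℝ (Fin d) → EuclideanSpace ℝ (Fin d)) : Prop where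
  weakGradient : HasWeakGradientOn Ω u G
  energy_ne_top : ∫⁻ x in Ω, ENNReal.ofReal (ρ x ^ γ) * ‖G x‖ₑ ^ 2 ≠ ⊤
  norm_ne_top : ∫⁻ x in Ω, ENNReal.ofReal (ρ x ^ α) * ‖u x‖ₑ ^ 2 ≠ ⊤
  norm_ne_zero : ∫⁻ x in Ω, ENNReal.ofReal (ρ x ^ α) * ‖u x‖ₑ ^ 2 ≠ 0
  mean_zero : ∫ x in Ω, ρ x ^ α * u x = 0

/-- The `(α, γ)`-principal eigenvalue `λ₂` of `ρ` on `Ω`. -/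
def principalEigenvalue {d : ℕ} (Ω : Set (EuclideanSpace ℝ (Fin d)))
    (ρ : EuclideanSpace ℝ (Fin d) → ℝ) (α γ : ℝ) : ℝ≥0∞ :=
  ⨅ (u : EuclideanSpace ℝ (Fin d) → ℝ)
    (G : EuclideanSpace ℝ (Fin d) → EuclideanSpace ℝ (Fin d))
    (_ : IsRayleighCompetitor Ω ρ α γ u G), rayleighQuotient Ω ρ α γ u G

/-- `u` is an `(α, γ)`-principal eigenfunction of `ρ` on `Ω`: a competitor that attains `λ₂`. -/
def IsPrincipalEigenfunction {d : ℕ} (Ω : Set (EuclideanSpace ℝ (Fin d)))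
    (ρ : EuclideanSpace ℝ (Fin d) → ℝ) (α γ : ℝ) (u : EuclideanSpace ℝ (Fin d) → ℝ) : Prop :=
  ∃ G : EuclideanSpace ℝ (Fin d) → EuclideanSpace ℝ (Fin d),
    IsRayleighCompetitor Ω ρ α γ u G ∧
      rayleighQuotient Ω ρ α γ u G = principalEigenvalue Ω ρ α γ

end

/-! This is Cheeger's argument with weights. Let `m` be a median of `u` for the measure `ρ^α dx`.
For `t ≥ m` the set `{u > t}` is the lighter side of its cut, and for `t < m` its complement is; so
the sparsity `Φ` of the sweep times the mass of the lighter side is at most the perimeter of `{u >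
t}`. Multiply by `2|t - m|` and integrate over `t`. By the layer cake formula
(`lintegral_sq_sub_eq`) the left side becomes `Φ ∫ ρ^α (u - m)²`; by the coarea inequality the right
side is at most `2 ∫ ρ^β |∇u| |u - m|`. Since `2β = α + γ`, Cauchy-Schwarz bounds the square of the
latter by `4 ∫ ρ^α (u - m)² · ∫ ρ^γ |∇u|²`. Cancelling one factor and using `∫ ρ^α u² ≤ ∫ ρ^α (u -
m)²`, which holds because `u` has mean zero, gives `Φ² ≤ 4 R(u)`. Minimality of `u` enters only
through `R(u) = λ₂`.

Only one direction of the coarea formula is needed, for almost every `t`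
(`HasWeakGradientOn.ae_weightedPerimeter_le_rnDeriv`). The indicator of `{u > t}` is replaced by a
ramp of width `2ε` in `u`. The chain rule turns the flux of a test field into an integral over `{|u
- t| ≤ ε}`, bounded by nearly `ν[t - ε, t + ε] / 2ε`, where `ν` is the image of `ρ^β |∇u| dx` under
`u`. Differentiation of measures then yields the density of `ν` at `t`. The chain rule itself is
proved by mollification. -/

open Filter Topology Convolution

/-! ### Convergence of mollifications in `L¹` -/

section Mollification

variable {E : Type*} [NormedAddCommGroup E] [InnerProductSpace ℝ E] [FiniteDimensional ℝ E]
  [MeasurableSpace E] [BorelSpace E] {μ : Measure E} [μ.IsAddHaarMeasure]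

theorem ContDiffBump.integrable_normed_convolution (ψ : ContDiffBump (0 : E)) {g : E → ℝ}
    (hg : Integrable g μ) :
    Integrable (ψ.normed μ ⋆[ContinuousLinearMap.lsmul ℝ ℝ, μ] g) μ :=
  ψ.integrable_normed.integrable_convolution _ hg

theorem ContDiffBump.integral_normed_convolution (ψ : ContDiffBump (0 : E)) {g : E → ℝ}
    (hg : Integrable g μ) :
    ∫ x, (ψ.normed μ ⋆[ContinuousLinearMap.lsmul ℝ ℝ, μ] g) x ∂μ = ∫ x, g x ∂μ := by
  rw [integral_convolution _ ψ.integrable_normed hg, ψ.integral_normed]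
  simp

/-- Mollifications of an integrable function converge to it in `L¹`. -/
theorem ContDiffBump.tendsto_integral_abs_convolution_sub {ψ : ℕ → ContDiffBump (0 : E)} {K : ℝ}
    (hψ : Tendsto (fun n => (ψ n).rOut) atTop (𝓝 0)) (hK : ∀ n, (ψ n).rOut ≤ K * (ψ n).rIn)
    {g : E → ℝ} (hg : Integrable g μ) :
    Tendsto (fun n => ∫ x, |((ψ n).normed μ ⋆[ContinuousLinearMap.lsmul ℝ ℝ, μ] g) x - g x| ∂μ)
      atTop (𝓝 0) := by
  set c : ℕ → E → ℝ := fun n => (ψ n).normed μ ⋆[ContinuousLinearMap.lsmul ℝ ℝ, μ] g with hc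
  set b : ℕ → E → ℝ := fun n => (ψ n).normed μ ⋆[ContinuousLinearMap.lsmul ℝ ℝ, μ] fun y => |g y|
    with hb
  have hci : ∀ n, Integrable (c n) μ := fun n => (ψ n).integrable_normed_convolution hg
  have hbi : ∀ n, Integrable (b n) μ := fun n => (ψ n).integrable_normed_convolution hg.abs
  have hcb : ∀ n x, |c n x| ≤ b n x := fun n x => by
    simp only [hc, hb, convolution_def, ContinuousLinearMap.lsmul_apply, smul_eq_mul]
    refine abs_integral_le_integral_abs.trans (le_of_eq ?_)
    simp only [abs_mul, abs_of_nonneg ((ψ n).nonneg_normed _)]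
  have hci' : ∀ n, Integrable (fun x => |c n x - g x|) μ := fun n => ((hci n).sub hg).abs
  -- The functions `|c n - g|` need not have a common integrable majorant. Instead `h n` is
  -- nonnegative, tends to `2|g|` a.e., and has integral `2∫|g| - ∫|c n - g|`; cutting it off at
  -- `2|g|` makes dominated convergence available and only lowers the integral.
  set h : ℕ → E → ℝ := fun n x => b n x + |g x| - |c n x - g x| with hh
  have hhi : ∀ n, Integrable (h n) μ := fun n => ((hbi n).add hg.abs).sub (hci' n)
  have hh0 : ∀ n x, 0 ≤ h n x := fun n x => by
    have := abs_sub (c n x) (g x)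
    have := hcb n x
    simp only [hh]; linarith
  have hhint : ∀ n, ∫ x, h n x ∂μ = 2 * ∫ x, |g x| ∂μ - ∫ x, |c n x - g x| ∂μ := fun n => by
    have h1 : ∫ x, b n x ∂μ = ∫ x, |g x| ∂μ := (ψ n).integral_normed_convolution hg.abs
    simp only [hh]
    have h2 := integral_sub ((hbi n).add hg.abs) (hci' n)
    have h3 := integral_add (hbi n) hg.abs
    simp only [Pi.add_apply] at h2 h3
    rw [h2, h3, h1]
    ring
  have hmi : ∀ n, Integrable (fun x => min (h n x) (2 * |g x|)) μ := fun n =>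
    (hhi n).inf (hg.abs.const_mul 2)
  have hlim : Tendsto (fun n => ∫ x, min (h n x) (2 * |g x|) ∂μ) atTop
      (𝓝 (∫ x, 2 * |g x| ∂μ)) := by
    refine tendsto_integral_of_dominated_convergence (fun x => 2 * |g x|)
      (fun n => (hmi n).aestronglyMeasurable) (hg.abs.const_mul 2) (fun n => ?_) ?_
    · refine Eventually.of_forall fun x => ?_
      rw [Real.norm_eq_abs, abs_of_nonneg (le_min (hh0 n x) (by positivity))]
      exact min_le_right _ _
    · filter_upwards [ae_convolution_tendsto_right_of_locallyIntegrable hψ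
        (Eventually.of_forall hK) hg.locallyIntegrable,
        ae_convolution_tendsto_right_of_locallyIntegrable hψ
        (Eventually.of_forall hK) hg.abs.locallyIntegrable] with x h1 h2
      have h3 : Tendsto (fun n => h n x) atTop (𝓝 (|g x| + |g x| - |g x - g x|)) :=
        (h2.add tendsto_const_nhds).sub ((h1.sub tendsto_const_nhds).abs)
      have h4 := h3.min (tendsto_const_nhds (x := 2 * |g x|))
      convert! h4 using 2
      rw [sub_self, abs_zero, sub_zero, ← two_mul, min_self]
  have hlim' : Tendsto (fun n => 2 * ∫ x, |g x| ∂μ - ∫ x, min (h n x) (2 * |g x|) ∂μ) atTop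
      (𝓝 0) := by
    have := (tendsto_const_nhds (x := 2 * ∫ x, |g x| ∂μ)).sub hlim
    rwa [integral_const_mul, sub_self] at this
  refine squeeze_zero (fun n => integral_nonneg fun x => abs_nonneg _) (fun n => ?_) hlim'
  have h1 := integral_mono (hmi n) (hhi n) fun x => min_le_left _ _
  have h2 := hhint n
  linarith

end Mollification

/-! ### Chain rule for weak gradients -/

section WeakGradient

variable {d : ℕ} {Ω : Set (EuclideanSpace ℝ (Fin d))} {u : EuclideanSpace ℝ (Fin d) → ℝ}
  {G : EuclideanSpace ℝ (Fin d) → EuclideanSpace ℝ (Fin d)}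

/-- Away from the boundary, the gradient of a mollification is the mollification of the weak
gradient. -/
theorem HasWeakGradientOn.fderiv_mollification (h : HasWeakGradientOn Ω u G) (hΩ : IsOpen Ω)
    {K : Set (EuclideanSpace ℝ (Fin d))} (hK : IsCompact K) (hKΩ : K ⊆ Ω)
    (ψ : ContDiffBump (0 : EuclideanSpace ℝ (Fin d))) {x : EuclideanSpace ℝ (Fin d)}
    (hx : Metric.closedBall x ψ.rOut ⊆ K) (v : EuclideanSpace ℝ (Fin d)) :
    fderiv ℝ (ψ.normed volume ⋆[ContinuousLinearMap.lsmul ℝ ℝ, volume] K.indicator u) x v =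
      (ψ.normed volume ⋆[ContinuousLinearMap.lsmul ℝ ℝ, volume]
        K.indicator fun y => inner ℝ (G y) v) x := by
  have hui : Integrable (K.indicator u) volume := by
    rw [integrable_indicator_iff hK.measurableSet]
    exact h.locallyIntegrable.integrableOn_compact_subset hKΩ hK
  have hsm : ContDiff ℝ ∞ (ψ.normed volume) := ψ.contDiff_normed
  -- The kernel centred at `x` sees only points of `K`, so truncating `u` and `G` to `K` changes
  -- nothing at `x`.
  have hψs : ∀ y, x - y ∈ tsupport (ψ.normed volume) → y ∈ K := fun y hy => hx <| by
    rw [ψ.tsupport_normed_eq] at hy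
    simpa [dist_eq_norm, norm_sub_rev] using hy
  have hcs : HasCompactSupport (ψ.normed volume) := ψ.hasCompactSupport_normed
  rw [(hcs.hasFDerivAt_convolution_left (ContinuousLinearMap.lsmul ℝ ℝ) (hsm.of_le (by simp))
    hui.locallyIntegrable x).fderiv]
  have hex := (HasCompactSupport.convolutionExists_left
    ((ContinuousLinearMap.lsmul ℝ ℝ).precompL (EuclideanSpace ℝ (Fin d))) (hcs.fderiv (𝕜 := ℝ))
    (hsm.continuous_fderiv (by simp)) hui.locallyIntegrable) x
  rw [convolution_def, ContinuousLinearMap.integral_apply hex]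
  simp only [ContinuousLinearMap.precompL_apply, ContinuousLinearMap.lsmul_apply]
  have hφ : ContDiff ℝ ∞ (fun y => ψ.normed volume (x - y)) :=
    hsm.comp (contDiff_const.sub contDiff_id)
  have hφs : tsupport (fun y => ψ.normed volume (x - y)) ⊆ K := by
    refine (tsupport_comp_subset_preimage (ψ.normed volume)
      (continuous_const.sub continuous_id : Continuous fun y => x - y)).trans fun y hy => hψs y hy
  have hφd : ∀ y, fderiv ℝ (fun y => ψ.normed volume (x - y)) y v =
      - fderiv ℝ (ψ.normed volume) (x - y) v := fun y => by
    have h1 : HasFDerivAt (fun y => x - y)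
        (-ContinuousLinearMap.id ℝ (EuclideanSpace ℝ (Fin d))) y := by
      simpa using (hasFDerivAt_id y).const_sub x
    have h2 := ((hsm.differentiable (by simp)) (x - y)).hasFDerivAt.comp y h1
    have h3 := h2.fderiv
    simp only [Function.comp_def] at h3
    rw [h3]; simp
  -- The test function is the reflected kernel `y ↦ ψ (x - y)`; the sign from the reflection cancels
  -- the one in the definition of the weak gradient.
  have key := h.integral_eq _ hφ (hK.of_isClosed_subset (isClosed_tsupport _) hφs)
    (hφs.trans hKΩ) v
  rw [← integral_sub_left_eq_self _ volume x]
  simp only [sub_sub_cancel]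
  rw [convolution_eq_swap]
  simp only [ContinuousLinearMap.lsmul_apply, smul_eq_mul]
  rw [← integral_indicator hΩ.measurableSet, ← integral_indicator hΩ.measurableSet] at key
  have e1 : ∀ y, Ω.indicator (fun y => u y * fderiv ℝ (fun y => ψ.normed volume (x - y)) y v) y =
      - (fderiv ℝ (ψ.normed volume) (x - y) v * K.indicator u y) := fun y => by
    by_cases hy : y ∈ K
    · rw [indicator_of_mem (hKΩ hy), indicator_of_mem hy, hφd]; ring
    · have h0 : fderiv ℝ (ψ.normed volume) (x - y) = 0 := by
        by_contra h0
        exact hy (hψs y (support_fderiv_subset ℝ h0))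
      rw [indicator_of_notMem hy]
      simp [indicator, hφd, h0]
  have e2 : ∀ y, Ω.indicator (fun y => inner ℝ (G y) v * ψ.normed volume (x - y)) y =
      ψ.normed volume (x - y) * K.indicator (fun y => inner ℝ (G y) v) y := fun y => by
    by_cases hy : y ∈ K
    · rw [indicator_of_mem (hKΩ hy), indicator_of_mem hy]; ring
    · have h0 : ψ.normed volume (x - y) = 0 := by
        by_contra h0
        exact hy (hψs y (subset_tsupport _ h0))
      rw [indicator_of_notMem hy]
      simp [indicator, h0]
  simp only [e1, e2, integral_neg, neg_inj] at key
  simpa using key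

/-- Chain rule for weak gradients, tested against a smooth compactly supported function. -/
theorem HasWeakGradientOn.integral_comp_mul_fderiv (h : HasWeakGradientOn Ω u G) (hΩ : IsOpen Ω)
    {η θ : ℝ → ℝ} (hη : ∀ s, HasDerivAt η (θ s) s) (hθ : Continuous θ) {C : ℝ}
    (hηC : ∀ s, |η s| ≤ C) (hθC : ∀ s, |θ s| ≤ C) {φ : EuclideanSpace ℝ (Fin d) → ℝ}
    (hφ : ContDiff ℝ ∞ φ) (hφc : HasCompactSupport φ) (hφΩ : tsupport φ ⊆ Ω)
    (v : EuclideanSpace ℝ (Fin d)) :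
    ∫ x in Ω, η (u x) * fderiv ℝ φ x v = - ∫ x in Ω, θ (u x) * (inner ℝ (G x) v * φ x) := by
  have hηc : Continuous η := continuous_iff_continuousAt.2 fun s => (hη s).continuousAt
  -- The thickening leaves room to mollify at radius up to `δ` around the support of `φ` without
  -- leaving a compact subset of `Ω`.
  obtain ⟨δ, hδ, hδΩ⟩ := hφc.isCompact.exists_cthickening_subset_open hΩ hφΩ
  set K := Metric.cthickening δ (tsupport φ) with hKdef
  have hK : IsCompact K := hφc.isCompact.cthickening
  have hSK : tsupport φ ⊆ K := Metric.self_subset_cthickening _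
  have hui : Integrable (K.indicator u) volume := by
    rw [integrable_indicator_iff hK.measurableSet]
    exact h.locallyIntegrable.integrableOn_compact_subset hδΩ hK
  set g : EuclideanSpace ℝ (Fin d) → ℝ := K.indicator fun y => inner ℝ (G y) v with hg
  have hgi : Integrable g volume := by
    rw [hg, integrable_indicator_iff hK.measurableSet]
    exact (h.locallyIntegrable_grad.integrableOn_compact_subset hδΩ hK).inner_const v
  let ψ : ℕ → ContDiffBump (0 : EuclideanSpace ℝ (Fin d)) := fun n =>
    ⟨δ / (n + 1) / 2, δ / (n + 1), by positivity, half_lt_self (by positivity)⟩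
  have hψ : Tendsto (fun n => (ψ n).rOut) atTop (𝓝 0) := by
    have := (tendsto_one_div_add_atTop_nhds_zero_nat (𝕜 := ℝ)).const_mul δ
    simpa [ψ, div_eq_mul_inv] using this
  -- A bounded ratio of the radii is what a.e. convergence of the mollifications requires.
  have hψK : ∀ n, (ψ n).rOut ≤ 2 * (ψ n).rIn := fun n => by simp only [ψ]; linarith
  have hψS : ∀ n, ∀ x ∈ tsupport φ, Metric.closedBall x (ψ n).rOut ⊆ K := fun n x hx => by
    refine (Metric.closedBall_subset_cthickening hx _).trans (Metric.cthickening_mono ?_ _)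
    exact div_le_self hδ.le (by simp)
  set un : ℕ → EuclideanSpace ℝ (Fin d) → ℝ := fun n =>
    (ψ n).normed volume ⋆[ContinuousLinearMap.lsmul ℝ ℝ, volume] K.indicator u with hun
  set gn : ℕ → EuclideanSpace ℝ (Fin d) → ℝ := fun n =>
    (ψ n).normed volume ⋆[ContinuousLinearMap.lsmul ℝ ℝ, volume] g with hgn
  have hunsm : ∀ n, ContDiff ℝ 1 (un n) := fun n =>
    (ψ n).hasCompactSupport_normed.contDiff_convolution_left _ (n := 1)
      (ψ n).contDiff_normed hui.locallyIntegrable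
  have hgni : ∀ n, Integrable (gn n) volume := fun n => (ψ n).integrable_normed_convolution hgi
  have hderiv : ∀ n x, HasFDerivAt (fun x => η (un n x)) (θ (un n x) • fderiv ℝ (un n) x) x :=
    fun n x => (hη (un n x)).comp_hasFDerivAt x
      (((hunsm n).differentiable (by simp)) x).hasFDerivAt
  have hφ1 : Continuous fun x => fderiv ℝ φ x v :=
    (hφ.continuous_fderiv (by simp)).clm_apply continuous_const
  have hφ1c : HasCompactSupport fun x => fderiv ℝ φ x v :=
    (hφc.fderiv (𝕜 := ℝ)).comp_left (g := fun l : EuclideanSpace ℝ (Fin d) →L[ℝ] ℝ => l v) rfl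
  have hφ1i : Integrable (fun x => fderiv ℝ φ x v) volume :=
    hφ1.integrable_of_hasCompactSupport hφ1c
  obtain ⟨B, hB⟩ := hφ.continuous.bounded_above_of_compact_support hφc
  have hB0 : 0 ≤ B := (norm_nonneg _).trans (hB 0)
  have hC0 : 0 ≤ C := (abs_nonneg _).trans (hηC 0)
  -- integration by parts for the mollified functions
  have hibp : ∀ n, ∫ x, η (un n x) * fderiv ℝ φ x v = - ∫ x, θ (un n x) * (gn n x * φ x) := by
    intro n
    have hd : ∀ x, fderiv ℝ (fun x => η (un n x)) x v = θ (un n x) * fderiv ℝ (un n) x v :=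
      fun x => by rw [(hderiv n x).fderiv]; rfl
    have hc1 : Continuous fun x => η (un n x) := hηc.comp (hunsm n).continuous
    have hc2 : Continuous fun x => fderiv ℝ (fun x => η (un n x)) x v := by
      simp only [hd]
      exact (hθ.comp (hunsm n).continuous).mul
        (((hunsm n).continuous_fderiv (by simp)).clm_apply continuous_const)
    rw [integral_mul_fderiv_eq_neg_fderiv_mul_of_integrable
      ((hc2.mul hφ.continuous).integrable_of_hasCompactSupport hφc.mul_left)
      ((hc1.mul hφ1).integrable_of_hasCompactSupport hφ1c.mul_left)
      ((hc1.mul hφ.continuous).integrable_of_hasCompactSupport hφc.mul_left)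
      (fun x _ => (hderiv n x).differentiableAt)
      (fun x _ => hφ.differentiable (by simp) x)]
    congr 1
    refine integral_congr_ae (Eventually.of_forall fun x => ?_)
    simp only [hd]
    by_cases hx : x ∈ tsupport φ
    · have : fderiv ℝ (un n) x v = gn n x :=
        h.fderiv_mollification hΩ hK hδΩ (ψ n) (hψS n x hx) v
      rw [this]; ring
    · rw [image_eq_zero_of_notMem_tsupport hx]; ring
  have hae : ∀ᵐ x, Tendsto (fun n => un n x) atTop (𝓝 (K.indicator u x)) :=
    ContDiffBump.ae_convolution_tendsto_right_of_locallyIntegrable hψ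
      (Eventually.of_forall hψK) hui.locallyIntegrable
  have hl1 : Tendsto (fun n => ∫ x, η (un n x) * fderiv ℝ φ x v) atTop
      (𝓝 (∫ x, η (K.indicator u x) * fderiv ℝ φ x v)) := by
    refine tendsto_integral_of_dominated_convergence (fun x => C * |fderiv ℝ φ x v|)
      (fun n => ((hηc.comp (hunsm n).continuous).mul hφ1).aestronglyMeasurable)
      (hφ1i.abs.const_mul C) (fun n => Eventually.of_forall fun x => ?_) ?_
    · rw [Real.norm_eq_abs, abs_mul]
      exact mul_le_mul_of_nonneg_right (hηC _) (abs_nonneg _)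
    · filter_upwards [hae] with x hx
      exact ((hηc.tendsto _).comp hx).mul tendsto_const_nhds
  have hm1 : ∀ n, AEStronglyMeasurable (fun x => θ (un n x)) volume := fun n =>
    (hθ.comp (hunsm n).continuous).aestronglyMeasurable
  -- Write `θ(un) gn = θ(un) g + θ(un) (gn - g)`. The first term converges by domination, since `un`
  -- converges a.e.; the second vanishes because `θ` is bounded and `gn → g` in `L¹`.
  have hl2 : Tendsto (fun n => ∫ x, θ (un n x) * (g x * φ x)) atTop
      (𝓝 (∫ x, θ (K.indicator u x) * (g x * φ x))) := by
    refine tendsto_integral_of_dominated_convergence (fun x => C * (|g x| * B))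
      (fun n => (hm1 n).mul (hgi.aestronglyMeasurable.mul hφ.continuous.aestronglyMeasurable))
      ((hgi.abs.mul_const B).const_mul C) (fun n => Eventually.of_forall fun x => ?_) ?_
    · rw [Real.norm_eq_abs, abs_mul, abs_mul]
      have := hB x
      rw [Real.norm_eq_abs] at this
      have := hθC (un n x)
      gcongr
    · filter_upwards [hae] with x hx
      exact ((hθ.tendsto _).comp hx).mul tendsto_const_nhds
  have hl3 : Tendsto (fun n => ∫ x, θ (un n x) * ((gn n x - g x) * φ x)) atTop (𝓝 0) := by
    have hL1 := (ContDiffBump.tendsto_integral_abs_convolution_sub hψ hψK hgi).const_mul (C * B)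
    rw [mul_zero] at hL1
    refine squeeze_zero_norm (fun n => ?_) hL1
    refine (norm_integral_le_integral_norm _).trans ?_
    rw [← integral_const_mul]
    refine integral_mono_of_nonneg (Eventually.of_forall fun x => norm_nonneg _)
      (((hgni n).sub hgi).abs.const_mul _) (Eventually.of_forall fun x => ?_)
    simp only [Real.norm_eq_abs, abs_mul]
    have h1 := hB x
    rw [Real.norm_eq_abs] at h1
    have h2 := hθC (un n x)
    calc |θ (un n x)| * (|gn n x - g x| * |φ x|) ≤ C * (|gn n x - g x| * B) := by gcongr
      _ = C * B * |gn n x - g x| := by ring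
  have hbd : ∀ (n : ℕ) {f : EuclideanSpace ℝ (Fin d) → ℝ}, Integrable f volume →
      Integrable (fun x => θ (un n x) * (f x * φ x)) volume := fun n f hf =>
    (hf.mul_bdd hφ.continuous.aestronglyMeasurable (Eventually.of_forall hB)).bdd_mul (hm1 n)
      (Eventually.of_forall fun x => hθC _)
  have hl4 : Tendsto (fun n => - ∫ x, θ (un n x) * (gn n x * φ x)) atTop
      (𝓝 (- ∫ x, θ (K.indicator u x) * (g x * φ x))) := by
    have := (hl3.add hl2).neg
    rw [zero_add] at this
    refine this.congr fun n => ?_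
    have hadd := integral_add (hbd n ((hgni n).sub hgi)) (hbd n hgi)
    simp only [Pi.sub_apply] at hadd
    rw [← hadd]
    congr 2
    ext x; ring
  have hfin := tendsto_nhds_unique (hl1.congr hibp) hl4
  have hz : ∀ x ∉ Ω, φ x = 0 := fun x hx =>
    image_eq_zero_of_notMem_tsupport fun hx' => hx (hφΩ hx')
  have hz' : ∀ x ∉ tsupport φ, fderiv ℝ φ x = 0 := fun x hx => by
    by_contra h0
    exact hx (support_fderiv_subset ℝ h0)
  rw [setIntegral_eq_integral_of_forall_compl_eq_zero (s := Ω),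
    setIntegral_eq_integral_of_forall_compl_eq_zero (s := Ω)]
  · convert! hfin using 2
    · ext x
      by_cases hx : x ∈ tsupport φ
      · rw [indicator_of_mem (hSK hx)]
      · simp [hz' x hx]
    · congr 1
      ext x
      by_cases hx : x ∈ tsupport φ
      · rw [hg, indicator_of_mem (hSK hx), indicator_of_mem (hSK hx)]
      · simp [image_eq_zero_of_notMem_tsupport hx]
  · intro x hx; simp [hz x hx]
  · intro x hx; simp [hz' x fun hx' => hx (hφΩ hx')]

/-! ### Smooth ramps and test vector fields -/

/-- A `C¹` approximation of the Heaviside function at `t`, with almost optimal slope. -/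
theorem exists_smooth_ramp (t : ℝ) {ε : ℝ} (hε : 0 < ε) (hε1 : ε < 1) :
    ∃ η θ : ℝ → ℝ, (∀ s, HasDerivAt η (θ s) s) ∧ Continuous θ ∧ (∀ s, 0 ≤ θ s) ∧
      (∀ s, θ s ≤ (1 - ε)⁻¹ * (2 * ε)⁻¹) ∧ (∀ s ∉ Metric.closedBall t ε, θ s = 0) ∧
      (∀ s, 0 ≤ η s) ∧ (∀ s, η s ≤ 1) ∧ (∀ s ≤ t - ε, η s = 0) ∧ (∀ s, t + ε ≤ s → η s = 1) := by
  have h1ε : 0 < 1 - ε := by linarith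
  -- The ramp is the primitive of this normalized bump. Its density is at most the inverse length
  -- `2(1 - ε)ε` of the inner ball, so an inner radius close to `ε` makes the slope nearly `1 / 2ε`.
  let f : ContDiffBump t := ⟨(1 - ε) * ε, ε, by positivity, by nlinarith⟩
  have hfc : Continuous (f.normed volume) := f.continuous_normed
  have hsupp : Function.support (f.normed volume) = Ioo (t - ε) (t + ε) := by
    rw [f.support_normed_eq, Real.ball_eq_Ioo]
  have hder : ∀ s, HasDerivAt (fun s => ∫ y in (t - ε)..s, f.normed volume y)
      (f.normed volume s) s := fun s => hfc.integral_hasStrictDerivAt _ _ |>.hasDerivAt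
  have hmono : Monotone (fun s => ∫ y in (t - ε)..s, f.normed volume y) :=
    monotone_of_deriv_nonneg (fun s => (hder s).differentiableAt)
      fun s => by rw [(hder s).deriv]; exact f.nonneg_normed s
  have h0 : ∀ s ≤ t - ε, ∫ y in (t - ε)..s, f.normed volume y = 0 := fun s hs => by
    rw [intervalIntegral.integral_congr (g := fun _ => (0 : ℝ)), intervalIntegral.integral_zero]
    intro y hy
    rw [uIcc_of_ge hs] at hy
    by_contra hy'
    have : y ∈ Function.support (f.normed volume) := hy'
    rw [hsupp] at this
    exact absurd hy.2 (not_le.2 this.1)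
  have h1 : ∀ s, t + ε ≤ s → ∫ y in (t - ε)..s, f.normed volume y = 1 := fun s hs => by
    rw [intervalIntegral.integral_eq_integral_of_support_subset, f.integral_normed]
    rw [hsupp]
    exact fun y hy => ⟨hy.1, hy.2.le.trans hs⟩
  refine ⟨_, f.normed volume, hder, hfc, f.nonneg_normed, fun s => ?_, fun s hs => ?_,
    fun s => ?_, fun s => ?_, h0, h1⟩
  · refine (f.normed_le_div_measure_closedBall_rIn volume s).trans (le_of_eq ?_)
    rw [Real.volume_real_closedBall (by positivity)]
    simp only [f]
    field_simp
  · by_contra hs'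
    have : s ∈ Function.support (f.normed volume) := hs'
    rw [f.support_normed_eq] at this
    exact hs (Metric.ball_subset_closedBall this)
  · have := hmono (min_le_left s (t - ε))
    simp only [h0 _ (min_le_right s (t - ε))] at this
    exact this
  · have := hmono (le_max_left s (t + ε))
    simp only [h1 _ (le_max_right s (t + ε))] at this
    exact this

theorem HasWeakGradientOn.aemeasurable (h : HasWeakGradientOn Ω u G) :
    AEMeasurable u (volume.restrict Ω) :=
  (h.locallyIntegrable.aestronglyMeasurable).aemeasurable

theorem vectorDivergence_continuous
    {φ : EuclideanSpace ℝ (Fin d) → EuclideanSpace ℝ (Fin d)} (hφ : ContDiff ℝ ∞ φ) :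
    Continuous (vectorDivergence φ) := by
  refine continuous_finsetSum _ fun i _ => ?_
  exact (EuclideanSpace.proj (𝕜 := ℝ) i).continuous.comp
    ((hφ.continuous_fderiv (by simp)).clm_apply continuous_const)

theorem vectorDivergence_hasCompactSupport
    {φ : EuclideanSpace ℝ (Fin d) → EuclideanSpace ℝ (Fin d)} (hφc : HasCompactSupport φ) :
    HasCompactSupport (vectorDivergence φ) :=
  (hφc.fderiv (𝕜 := ℝ)).comp_left
    (g := fun l : EuclideanSpace ℝ (Fin d) →L[ℝ] EuclideanSpace ℝ (Fin d) =>
      ∑ i, l (EuclideanSpace.single i 1) i) (by simp)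

/-- Chain rule for weak gradients, tested against a smooth compactly supported vector field. -/
theorem HasWeakGradientOn.integral_comp_mul_vectorDivergence (h : HasWeakGradientOn Ω u G)
    (hΩ : IsOpen Ω) {η θ : ℝ → ℝ} (hη : ∀ s, HasDerivAt η (θ s) s) (hθ : Continuous θ) {C : ℝ}
    (hηC : ∀ s, |η s| ≤ C) (hθC : ∀ s, |θ s| ≤ C)
    {φ : EuclideanSpace ℝ (Fin d) → EuclideanSpace ℝ (Fin d)}
    (hφ : ContDiff ℝ ∞ φ) (hφc : HasCompactSupport φ) (hφΩ : tsupport φ ⊆ Ω) :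
    ∫ x in Ω, η (u x) * vectorDivergence φ x = - ∫ x in Ω, θ (u x) * inner ℝ (G x) (φ x) := by
  have hηc : Continuous η := continuous_iff_continuousAt.2 fun s => (hη s).continuousAt
  have hum := (h.aemeasurable).aestronglyMeasurable
  have hcomp : ∀ i, ContDiff ℝ ∞ fun x => φ x i := fun i =>
    (EuclideanSpace.proj (𝕜 := ℝ) i).contDiff.comp hφ
  have hcompc : ∀ i, HasCompactSupport fun x => φ x i := fun i =>
    hφc.comp_left (g := fun y : EuclideanSpace ℝ (Fin d) => y i) rfl
  have hcompΩ : ∀ i, tsupport (fun x => φ x i) ⊆ tsupport φ := fun i =>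
    closure_mono fun x hx hx' => hx (by simp [hx'])
  have hfd : ∀ i x v, fderiv ℝ (fun x => φ x i) x v = fderiv ℝ φ x v i := fun i x v => by
    have := (EuclideanSpace.proj (𝕜 := ℝ) i).hasFDerivAt.comp x
      (hφ.differentiable (by simp) x).hasFDerivAt
    exact congrArg (fun l => l v) this.fderiv
  have hi1 : ∀ i : Fin d, Integrable
      (fun x => η (u x) * fderiv ℝ φ x (EuclideanSpace.single i 1) i) (volume.restrict Ω) := by
    intro i
    refine Integrable.bdd_mul (c := C) ?_ (hηc.comp_aestronglyMeasurable hum)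
      (Eventually.of_forall fun x => hηC _)
    refine (Continuous.integrable_of_hasCompactSupport ?_ ?_).restrict
    · exact (EuclideanSpace.proj (𝕜 := ℝ) i).continuous.comp
        ((hφ.continuous_fderiv (by simp)).clm_apply continuous_const)
    · exact (hφc.fderiv (𝕜 := ℝ)).comp_left
        (g := fun l : EuclideanSpace ℝ (Fin d) →L[ℝ] EuclideanSpace ℝ (Fin d) =>
          l (EuclideanSpace.single i 1) i) (by simp)
  have hi2 : ∀ i : Fin d, Integrable
      (fun x => θ (u x) * (inner ℝ (G x) (EuclideanSpace.single i 1) * φ x i))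
      (volume.restrict Ω) := by
    intro i
    refine Integrable.bdd_mul (c := C) ?_ (hθ.comp_aestronglyMeasurable hum)
      (Eventually.of_forall fun x => hθC _)
    -- `G` is only locally integrable: integrability is obtained on the compact support of `φ` and
    -- extended by zero.
    have hGi := ((h.locallyIntegrable_grad.integrableOn_compact_subset hφΩ hφc.isCompact).inner_const
      (𝕜 := ℝ) (EuclideanSpace.single i (1 : ℝ)))
    obtain ⟨B, hB⟩ := (hcomp i).continuous.bounded_above_of_compact_support (hcompc i)
    have := hGi.mul_bdd (hcomp i).continuous.aestronglyMeasurable (Eventually.of_forall hB)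
    refine (IntegrableOn.integrable_of_forall_notMem_eq_zero (s := tsupport φ) this
      fun x hx => ?_).restrict
    simp [image_eq_zero_of_notMem_tsupport hx]
  have e1 : ∀ x, η (u x) * vectorDivergence φ x =
      ∑ i, η (u x) * fderiv ℝ φ x (EuclideanSpace.single i 1) i := fun x => by
    rw [vectorDivergence, Finset.mul_sum]
  have e2 : ∀ x, θ (u x) * inner ℝ (G x) (φ x) =
      ∑ i, θ (u x) * (inner ℝ (G x) (EuclideanSpace.single i 1) * φ x i) := fun x => by
    rw [← Finset.mul_sum]
    congr 1
    simp [PiLp.inner_apply, mul_comm]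
  simp only [e1, e2]
  rw [integral_finsetSum _ fun i _ => hi1 i, integral_finsetSum _ fun i _ => hi2 i,
    ← Finset.sum_neg_distrib]
  refine Finset.sum_congr rfl fun i _ => ?_
  have := h.integral_comp_mul_fderiv hΩ hη hθ hηC hθC (hcomp i) (hcompc i)
    ((hcompΩ i).trans hφΩ) (EuclideanSpace.single i 1)
  simpa only [hfd] using this

/-! ### Coarea inequality -/

/-- The distribution on `ℝ` of the values of `u` with respect to `ρ^β |G| dx` on `Ω`. -/
noncomputable def variationMeasure (Ω : Set (EuclideanSpace ℝ (Fin d)))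
    (ρ : EuclideanSpace ℝ (Fin d) → ℝ) (β : ℝ) (u : EuclideanSpace ℝ (Fin d) → ℝ)
    (G : EuclideanSpace ℝ (Fin d) → EuclideanSpace ℝ (Fin d)) : Measure ℝ :=
  ((volume.restrict Ω).withDensity fun x => ENNReal.ofReal (ρ x ^ β) * ‖G x‖ₑ).map u

theorem variationMeasure_apply (h : HasWeakGradientOn Ω u G)
    (ρ : EuclideanSpace ℝ (Fin d) → ℝ) (β : ℝ) {s : Set ℝ} (hs : MeasurableSet s) :
    variationMeasure Ω ρ β u G s =
      ∫⁻ x in u ⁻¹' s, ENNReal.ofReal (ρ x ^ β) * ‖G x‖ₑ ∂(volume.restrict Ω) := by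
  rw [variationMeasure, Measure.map_apply_of_aemeasurable
    ((h.aemeasurable).mono_ac (withDensity_absolutelyContinuous _ _)) hs, withDensity_apply']

/-- Bound for the flux of a test field through a smoothed level set. -/
theorem HasWeakGradientOn.ofReal_integral_ramp_le (h : HasWeakGradientOn Ω u G) (hΩ : IsOpen Ω)
    {ρ : EuclideanSpace ℝ (Fin d) → ℝ} {β : ℝ} {η θ : ℝ → ℝ}
    (hη : ∀ s, HasDerivAt η (θ s) s) (hθ : Continuous θ) {c : ℝ} (hη0 : ∀ s, 0 ≤ η s)
    (hη1 : ∀ s, η s ≤ 1) (hθ0 : ∀ s, 0 ≤ θ s) (hθc : ∀ s, θ s ≤ c) {t ε : ℝ}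
    (hθs : ∀ s ∉ Metric.closedBall t ε, θ s = 0)
    {φ : EuclideanSpace ℝ (Fin d) → EuclideanSpace ℝ (Fin d)}
    (hφ : ContDiff ℝ ∞ φ) (hφc : HasCompactSupport φ) (hφΩ : tsupport φ ⊆ Ω)
    (hφρ : ∀ x ∈ Ω, ‖φ x‖ ≤ ρ x ^ β) :
    ENNReal.ofReal (∫ x in Ω, η (u x) * vectorDivergence φ x) ≤
      ENNReal.ofReal c * variationMeasure Ω ρ β u G (Metric.closedBall t ε) := by
  rw [h.integral_comp_mul_vectorDivergence hΩ (C := max 1 c) hη hθ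
    (fun s => (abs_of_nonneg (hη0 s)).le.trans ((hη1 s).trans (le_max_left _ _)))
    (fun s => (abs_of_nonneg (hθ0 s)).le.trans ((hθc s).trans (le_max_right _ _)))
    hφ hφc hφΩ, variationMeasure_apply h ρ β measurableSet_closedBall]
  calc ENNReal.ofReal (- ∫ x in Ω, θ (u x) * inner ℝ (G x) (φ x))
      ≤ ‖- ∫ x in Ω, θ (u x) * inner ℝ (G x) (φ x)‖ₑ := Real.ofReal_le_enorm _
    _ = ‖∫ x in Ω, θ (u x) * inner ℝ (G x) (φ x)‖ₑ := enorm_neg _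
    _ ≤ ∫⁻ x in Ω, ‖θ (u x) * inner ℝ (G x) (φ x)‖ₑ := enorm_integral_le_lintegral_enorm _
    _ ≤ ∫⁻ x in Ω, (u ⁻¹' Metric.closedBall t ε).indicator
          (fun x => ENNReal.ofReal c * (ENNReal.ofReal (ρ x ^ β) * ‖G x‖ₑ)) x := by
        refine setLIntegral_mono_ae' hΩ.measurableSet (Eventually.of_forall fun x hx => ?_)
        by_cases hux : u x ∈ Metric.closedBall t ε
        · rw [indicator_of_mem (show x ∈ u ⁻¹' Metric.closedBall t ε from hux), enorm_mul, Real.enorm_of_nonneg (hθ0 _)]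
          refine mul_le_mul' (ENNReal.ofReal_le_ofReal (hθc _)) ?_
          rw [← ofReal_norm (G x), ← ENNReal.ofReal_mul ((norm_nonneg _).trans (hφρ x hx)),
            ← ofReal_norm]
          refine ENNReal.ofReal_le_ofReal ((norm_inner_le_norm _ _).trans ?_)
          rw [mul_comm]
          exact mul_le_mul_of_nonneg_right (hφρ x hx) (norm_nonneg _)
        · simp [hθs _ hux]
    _ ≤ ∫⁻ x in u ⁻¹' Metric.closedBall t ε,
          ENNReal.ofReal c * (ENNReal.ofReal (ρ x ^ β) * ‖G x‖ₑ) ∂(volume.restrict Ω) :=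
        lintegral_indicator_le _ _
    _ = _ := lintegral_const_mul' _ _ ENNReal.ofReal_ne_top

/-- Coarea inequality: for almost every `t`, the weighted perimeter of `{u > t}` is at most the
density at `t` of the distribution of the values of `u` with respect to `ρ^β |G| dx`. -/
theorem HasWeakGradientOn.ae_weightedPerimeter_le_rnDeriv (h : HasWeakGradientOn Ω u G)
    (hΩ : IsOpen Ω) (ρ : EuclideanSpace ℝ (Fin d) → ℝ) (β : ℝ)
    [IsFiniteMeasure (variationMeasure Ω ρ β u G)] :
    ∀ᵐ t : ℝ, weightedPerimeter Ω ρ β {x | t < u x} ≤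
      (variationMeasure Ω ρ β u G).rnDeriv volume t := by
  set ν := variationMeasure Ω ρ β u G
  have hum := h.aemeasurable
  -- Only countably many level sets have positive measure; off those `t`, the ramps of `u` tend a.e.
  -- to the indicator of `{u > t}`.
  have hlev : ∀ᵐ t : ℝ, (volume.restrict Ω) {x | u x = t} = 0 := by
    have := (Measure.countable_meas_level_set_pos₀ hum.nullMeasurable).ae_notMem volume
    filter_upwards [this] with t ht
    simpa using ht
  -- Both exceptional sets of `t` are fixed before `φ`, so the bound passes to the supremum over
  -- uncountably many fields.
  filter_upwards [Besicovitch.ae_tendsto_rnDeriv ν volume, hlev] with t ht hlt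
  refine iSup_le fun φ => iSup_le fun hφ => iSup_le fun hφc => iSup_le fun hφΩ =>
    iSup_le fun hφρ => ?_
  -- The shift by `2` keeps `ε < 1` already at `n = 0`, as the ramps require.
  have hε0 : ∀ n : ℕ, (0 : ℝ) < 1 / ((n : ℝ) + 2) := fun n => by positivity
  have hε1 : ∀ n : ℕ, 1 / ((n : ℝ) + 2) < 1 := fun n => by
    rw [div_lt_one (by positivity)]
    have : (0 : ℝ) ≤ n := n.cast_nonneg
    linarith
  choose η θ hη hθ hθ0 hθc hθs hη0 hη1 hηl hηr using fun n : ℕ =>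
    exists_smooth_ramp t (hε0 n) (hε1 n)
  have hεlim : Tendsto (fun n : ℕ => 1 / ((n : ℝ) + 2)) atTop (𝓝 0) := by
    refine tendsto_const_nhds.div_atTop ?_
    exact tendsto_atTop_add_const_right _ _ tendsto_natCast_atTop_atTop
  have hdiv := vectorDivergence_continuous hφ
  have hdivi : Integrable (vectorDivergence φ) (volume.restrict Ω) :=
    (hdiv.integrable_of_hasCompactSupport (vectorDivergence_hasCompactSupport hφc)).restrict
  have hηc : ∀ n, Continuous (η n) := fun n =>
    continuous_iff_continuousAt.2 fun s => (hη n s).continuousAt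
  have hA : NullMeasurableSet {x | t < u x} (volume.restrict Ω) :=
    hum.nullMeasurable measurableSet_Ioi
  have hlimL : Tendsto (fun n => ∫ x in Ω, η n (u x) * vectorDivergence φ x) atTop
      (𝓝 (∫ x in {x | t < u x} ∩ Ω, vectorDivergence φ x)) := by
    rw [← Measure.restrict_restrict₀ hA, ← integral_indicator₀ hA]
    refine tendsto_integral_of_dominated_convergence (fun x => |vectorDivergence φ x|)
      (fun n => ((hηc n).comp_aestronglyMeasurable hum.aestronglyMeasurable).mul
        hdiv.aestronglyMeasurable) hdivi.abs
      (fun n => Eventually.of_forall fun x => ?_) ?_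
    · rw [Real.norm_eq_abs, abs_mul, abs_of_nonneg (hη0 n _)]
      exact mul_le_of_le_one_left (abs_nonneg _) (hη1 n _)
    · have hne : ∀ᵐ x ∂(volume.restrict Ω), u x ≠ t := by
        rw [ae_iff]; simpa using hlt
      filter_upwards [hne] with x hx
      rcases lt_or_gt_of_ne hx with hx | hx
      · refine Tendsto.congr' ?_ tendsto_const_nhds
        filter_upwards [hεlim.eventually (gt_mem_nhds (sub_pos.2 hx))] with n hn
        rw [hηl n _ (by linarith), indicator_of_notMem (by simpa using hx.le), zero_mul]
      · refine Tendsto.congr' ?_ tendsto_const_nhds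
        filter_upwards [hεlim.eventually (gt_mem_nhds (sub_pos.2 hx))] with n hn
        rw [hηr n _ (by linarith), indicator_of_mem (by simpa using hx), one_mul]
  have hlimR : Tendsto (fun n : ℕ => ENNReal.ofReal (1 - 1 / ((n : ℝ) + 2))⁻¹ *
      (ν (Metric.closedBall t (1 / ((n : ℝ) + 2))) /
        volume (Metric.closedBall t (1 / ((n : ℝ) + 2))))) atTop
      (𝓝 (1 * ν.rnDeriv volume t)) := by
    refine ENNReal.Tendsto.mul ?_ (Or.inl one_ne_zero) ?_ (Or.inr ENNReal.one_ne_top)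
    · have := ((tendsto_const_nhds (x := (1 : ℝ))).sub hεlim).inv₀ (by simp)
      simpa using ENNReal.tendsto_ofReal this
    · exact ht.comp (tendsto_nhdsWithin_iff.2 ⟨hεlim, Eventually.of_forall hε0⟩)
  rw [one_mul] at hlimR
  refine le_of_tendsto_of_tendsto' (ENNReal.tendsto_ofReal hlimL) hlimR fun n => ?_
  refine (h.ofReal_integral_ramp_le hΩ (hη n) (hθ n) (hη0 n) (hη1 n) (hθ0 n) (hθc n) (hθs n)
    hφ hφc hφΩ hφρ).trans (le_of_eq ?_)
  have := hε1 n
  have := hε0 n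
  rw [Real.volume_closedBall, ENNReal.ofReal_mul (inv_nonneg.2 (by linarith)), mul_assoc,
    ENNReal.ofReal_inv_of_pos (by linarith : (0 : ℝ) < 2 * (1 / ((n : ℝ) + 2))), ENNReal.div_eq_inv_mul]

/-! ### Median and layer cake on the line -/

/-- Existence of a median of a finite measure on the line. -/
theorem exists_median (P : Measure ℝ) [IsFiniteMeasure P] :
    ∃ m : ℝ, (∀ t, m ≤ t → P (Ioi t) ≤ P (Iic t)) ∧ ∀ t < m, P (Iic t) ≤ P (Ioi t) := by
  have hsum : ∀ t, P (Iic t) + P (Ioi t) = P univ := fun t => by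
    rw [← compl_Iic, measure_add_measure_compl measurableSet_Iic]
  rcases eq_or_ne P 0 with rfl | hP
  · exact ⟨0, by simp, by simp⟩
  have hP0 : P univ ≠ 0 := by simpa using hP
  have hhalf : P univ / 2 < P univ := ENNReal.half_lt_self hP0 (measure_ne_top _ _)
  -- The median is `sInf S`. Right continuity of `t ↦ P (Iic t)` puts the infimum itself in `S`,
  -- which settles the case `t = m`.
  set S : Set ℝ := {t | P univ / 2 ≤ P (Iic t)} with hS
  have hne : S.Nonempty :=
    (((tendsto_measure_Iic_atTop P).eventually (lt_mem_nhds hhalf)).mono fun t ht => ht.le).exists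
  have hbd : BddBelow S := by
    obtain ⟨b, hb⟩ := ((tendsto_measure_Ici_atBot P).eventually (lt_mem_nhds hhalf)).exists
    refine ⟨b, fun t ht => ?_⟩
    by_contra htb
    have hdisj : Disjoint (Iic t) (Ici b) :=
      Set.disjoint_left.2 fun y hy hy' => htb (le_trans hy' hy)
    have h1 : P (Iic t) + P (Ici b) ≤ P univ := by
      rw [← measure_union hdisj measurableSet_Ici]
      exact measure_mono (subset_univ _)
    rw [← ENNReal.add_halves (P univ)] at h1
    exact absurd h1 (not_le.2 (ENNReal.add_lt_add_of_le_of_lt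
      (ENNReal.div_lt_top (measure_ne_top _ _) two_ne_zero).ne ht hb))
  refine ⟨sInf S, fun t ht => ?_, fun t ht => ?_⟩
  · have hlim : Tendsto (P ∘ Iic) (𝓝[>] (sInf S)) (𝓝 (P (⋂ r > sInf S, Iic r))) :=
      tendsto_measure_biInter_gt (fun r _ => measurableSet_Iic.nullMeasurableSet)
        (fun i j _ hij => Iic_subset_Iic.2 hij) ⟨sInf S + 1, by simp, measure_ne_top _ _⟩
    have hI : ⋂ r > sInf S, Iic r = Iic (sInf S) := by
      ext y
      simp only [mem_iInter, mem_Iic]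
      exact ⟨fun hy => le_of_forall_gt_imp_ge_of_dense hy, fun hy r hr => hy.trans hr.le⟩
    rw [hI] at hlim
    have hm : P univ / 2 ≤ P (Iic (sInf S)) := by
      refine ge_of_tendsto hlim ?_
      filter_upwards [self_mem_nhdsWithin] with r hr
      obtain ⟨s, hs, hsr⟩ := exists_lt_of_csInf_lt hne hr
      exact le_trans hs (measure_mono (Iic_subset_Iic.2 hsr.le))
    have ht' : P univ / 2 ≤ P (Iic t) := hm.trans (measure_mono (Iic_subset_Iic.2 ht))
    refine le_trans ?_ ht'
    have h1 := hsum t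
    rw [← ENNReal.add_halves (P univ)] at h1
    by_contra hlt
    exact absurd h1 (ENNReal.add_lt_add_of_le_of_lt
      (ENNReal.div_lt_top (measure_ne_top _ _) two_ne_zero).ne ht' (not_le.1 hlt)).ne'
  · have ht' : P (Iic t) < P univ / 2 := not_le.1 fun h => notMem_of_lt_csInf ht hbd h
    refine ht'.le.trans ?_
    have h1 := hsum t
    rw [← ENNReal.add_halves (P univ)] at h1
    by_contra hlt
    exact absurd h1 (ENNReal.add_lt_add ht' (not_le.1 hlt)).ne

/-- Layer cake formula for the second moment about `m`. -/
theorem lintegral_sq_sub_eq (P : Measure ℝ) [IsFiniteMeasure P] (m : ℝ) :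
    ∫⁻ s, ENNReal.ofReal ((s - m) ^ 2) ∂P =
      ∫⁻ t, ENNReal.ofReal (2 * |t - m|) * (if m ≤ t then P (Ioi t) else P (Iic t)) := by
  -- `T` says that `t` lies between `m` and `s`, and `(s - m)²` is the integral of `2|t - m|` over
  -- such `t`. Strictness is chosen so that the slices at fixed `t` are exactly `Ioi t` and `Iic t`;
  -- then Tonelli applies.
  set T : Set (ℝ × ℝ) := {p | (m ≤ p.2 ∧ p.2 < p.1) ∨ (p.2 < m ∧ p.1 ≤ p.2)} with hT
  have hTm : MeasurableSet T :=
    ((measurableSet_le measurable_const measurable_snd).inter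
      (measurableSet_lt measurable_snd measurable_fst)).union
    ((measurableSet_lt measurable_snd measurable_const).inter
      (measurableSet_le measurable_fst measurable_snd))
  have hgm : Measurable fun t : ℝ => ENNReal.ofReal (2 * |t - m|) := by fun_prop
  have h1 : ∀ s, ENNReal.ofReal ((s - m) ^ 2) =
      ∫⁻ t, T.indicator (fun p => ENNReal.ofReal (2 * |p.2 - m|)) (s, t) := fun s => by
    have hcont : ∀ a b : ℝ, IntegrableOn (fun t => 2 * |t - m|) (Ioc a b) volume := fun a b =>
      (Continuous.integrableOn_Icc (by fun_prop)).mono_set Ioc_subset_Icc_self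
    have hnn : ∀ (μ : Measure ℝ), 0 ≤ᵐ[μ] fun t => 2 * |t - m| := fun μ =>
      Eventually.of_forall fun t => by positivity
    have hpr : ∀ a b : ℝ, ∫ t in a..b, 2 * (t - m) = (b - m) ^ 2 - (a - m) ^ 2 := fun a b => by
      rw [intervalIntegral.integral_eq_sub_of_hasDerivAt (f := fun t => (t - m) ^ 2)]
      · intro t _
        have h := ((hasDerivAt_id t).sub_const m).pow 2
        simp only [id, Nat.cast_ofNat, Nat.add_one_sub_one, pow_one, mul_one] at h
        exact h
      · exact Continuous.intervalIntegrable (by fun_prop) _ _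
    rcases le_total m s with hs | hs
    · have : ∀ t, T.indicator (fun p => ENNReal.ofReal (2 * |p.2 - m|)) (s, t) =
          (Ico m s).indicator (fun t => ENNReal.ofReal (2 * |t - m|)) t := fun t => by
        have : (s, t) ∈ T ↔ t ∈ Ico m s := by
          simp only [hT, mem_ofPred_eq, mem_Ico]
          refine ⟨fun h => h.elim id fun h => ?_, Or.inl⟩
          linarith [h.1, h.2]
        simp only [indicator, this]
      simp only [this]
      rw [lintegral_indicator measurableSet_Ico, setLIntegral_congr Ico_ae_eq_Ioc,
        ← ofReal_integral_eq_lintegral_ofReal (hcont m s) (hnn _)]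
      congr 1
      rw [← intervalIntegral.integral_of_le hs, intervalIntegral.integral_congr
        (g := fun t => 2 * (t - m)), hpr]
      · ring
      · intro t ht
        rw [uIcc_of_le hs] at ht
        simp only [abs_of_nonneg (sub_nonneg.2 ht.1)]
    · have : ∀ t, T.indicator (fun p => ENNReal.ofReal (2 * |p.2 - m|)) (s, t) =
          (Ico s m).indicator (fun t => ENNReal.ofReal (2 * |t - m|)) t := fun t => by
        have : (s, t) ∈ T ↔ t ∈ Ico s m := by
          simp only [hT, mem_ofPred_eq, mem_Ico]
          refine ⟨fun h => h.elim (fun h => ?_) And.symm, fun h => Or.inr h.symm⟩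
          linarith [h.1, h.2]
        simp only [indicator, this]
      simp only [this]
      rw [lintegral_indicator measurableSet_Ico, setLIntegral_congr Ico_ae_eq_Ioc,
        ← ofReal_integral_eq_lintegral_ofReal (hcont s m) (hnn _)]
      congr 1
      rw [← intervalIntegral.integral_of_le hs, intervalIntegral.integral_congr
        (g := fun t => -(2 * (t - m))), intervalIntegral.integral_neg, hpr]
      · ring
      · intro t ht
        rw [uIcc_of_le hs] at ht
        simp only [abs_of_nonpos (sub_nonpos.2 ht.2)]
        ring
  simp only [h1]
  rw [lintegral_lintegral_swap]
  · refine lintegral_congr fun t => ?_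
    by_cases ht : m ≤ t
    · have : ∀ s, T.indicator (fun p => ENNReal.ofReal (2 * |p.2 - m|)) (s, t) =
          (Ioi t).indicator (fun _ => ENNReal.ofReal (2 * |t - m|)) s := fun s => by
        simp [indicator, hT, ht, not_lt.2 ht]
      simp only [this, if_pos ht]
      rw [lintegral_indicator_const measurableSet_Ioi]
    · have : ∀ s, T.indicator (fun p => ENNReal.ofReal (2 * |p.2 - m|)) (s, t) =
          (Iic t).indicator (fun _ => ENNReal.ofReal (2 * |t - m|)) s := fun s => by
        simp [indicator, hT, ht, not_le.1 ht]
      simp only [this, if_neg ht]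
      rw [lintegral_indicator_const measurableSet_Iic]
  · exact ((hgm.comp measurable_snd).indicator hTm).aemeasurable

/-- Integrating the isoperimetric inequality for the sublevel and superlevel sets on the small
side of the median. -/
theorem mul_lintegral_sq_sub_le (P ν : Measure ℝ) [IsFiniteMeasure P] [IsFiniteMeasure ν] (m : ℝ)
    (Φ : ℝ≥0∞) (hr : ∀ᵐ t : ℝ, m ≤ t → Φ * P (Ioi t) ≤ ν.rnDeriv volume t)
    (hl : ∀ᵐ t : ℝ, t < m → Φ * P (Iic t) ≤ ν.rnDeriv volume t) :
    Φ * ∫⁻ s, ENNReal.ofReal ((s - m) ^ 2) ∂P ≤ ∫⁻ t, ENNReal.ofReal (2 * |t - m|) ∂ν := by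
  have hgm : Measurable fun t : ℝ => ENNReal.ofReal (2 * |t - m|) := by fun_prop
  rw [lintegral_sq_sub_eq]
  calc _ ≤ ∫⁻ t, Φ * (ENNReal.ofReal (2 * |t - m|) * (if m ≤ t then P (Ioi t) else P (Iic t))) :=
        lintegral_const_mul_le _ _
    _ ≤ ∫⁻ t, ν.rnDeriv volume t * ENNReal.ofReal (2 * |t - m|) := by
        refine lintegral_mono_ae ?_
        filter_upwards [hr, hl] with t hrt hlt
        rw [mul_left_comm, mul_comm]
        refine mul_le_mul_left ?_ _
        split_ifs with ht
        · exact hrt ht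
        · exact hlt (not_le.1 ht)
    _ = ∫⁻ t, ENNReal.ofReal (2 * |t - m|) ∂(volume.withDensity (ν.rnDeriv volume)) :=
        (lintegral_withDensity_eq_lintegral_mul _ (Measure.measurable_rnDeriv _ _) hgm).symm
    -- A singular part of `ν` only helps, so absolute continuity is not needed.
    _ ≤ _ := lintegral_mono' (Measure.withDensity_rnDeriv_le _ _) le_rfl

/-! ### Weighted Cauchy-Schwarz, sweep cuts and second moments -/

variable {ρ : EuclideanSpace ℝ (Fin d) → ℝ}

theorem aemeasurable_ofReal_rpow (hΩ : IsOpen Ω) (hρ_pos : ∀ x ∈ Ω, 0 < ρ x)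
    (hρ : ContinuousOn ρ Ω) (a : ℝ) :
    AEMeasurable (fun x => ENNReal.ofReal (ρ x ^ a)) (volume.restrict Ω) :=
  ((hρ.rpow_const fun x hx => Or.inl (hρ_pos x hx).ne').aemeasurable
    hΩ.measurableSet).ennreal_ofReal

/-- Cauchy-Schwarz inequality with the weights `ρ^α` and `ρ^γ`, where `2β = α + γ`. -/
theorem sq_lintegral_rpow_mul_le (hΩ : IsOpen Ω) (hρ_pos : ∀ x ∈ Ω, 0 < ρ x)
    (hρ : ContinuousOn ρ Ω) {α β γ : ℝ} (hβ : β = α / 2 + γ / 2)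
    {f g : EuclideanSpace ℝ (Fin d) → ℝ≥0∞} (hf : AEMeasurable f (volume.restrict Ω))
    (hg : AEMeasurable g (volume.restrict Ω)) :
    (∫⁻ x in Ω, ENNReal.ofReal (ρ x ^ β) * g x * f x) ^ 2 ≤
      (∫⁻ x in Ω, ENNReal.ofReal (ρ x ^ α) * f x ^ 2) *
        ∫⁻ x in Ω, ENNReal.ofReal (ρ x ^ γ) * g x ^ 2 := by
  have hsq : ∀ a : ℝ, ∀ x ∈ Ω, ENNReal.ofReal (ρ x ^ (a / 2)) ^ 2 = ENNReal.ofReal (ρ x ^ a) :=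
    fun a x hx => by
      have := hρ_pos x hx
      rw [← ENNReal.ofReal_pow (by positivity), ← Real.rpow_mul_natCast this.le]
      norm_num
  have h1 := ENNReal.lintegral_mul_le_Lp_mul_Lq (volume.restrict Ω) Real.HolderConjugate.two_two
    ((aemeasurable_ofReal_rpow hΩ hρ_pos hρ (α / 2)).mul hf)
    ((aemeasurable_ofReal_rpow hΩ hρ_pos hρ (γ / 2)).mul hg)
  have e0 : ∫⁻ x in Ω, ENNReal.ofReal (ρ x ^ β) * g x * f x =
      ∫⁻ x in Ω, ((fun x => ENNReal.ofReal (ρ x ^ (α / 2)) * f x) *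
        fun x => ENNReal.ofReal (ρ x ^ (γ / 2)) * g x) x := by
    refine setLIntegral_congr_fun hΩ.measurableSet fun x hx => ?_
    simp only [Pi.mul_apply]
    have := hρ_pos x hx
    rw [hβ, Real.rpow_add this, ENNReal.ofReal_mul (by positivity)]
    ring
  have e1 : ∀ (a : ℝ) (k : EuclideanSpace ℝ (Fin d) → ℝ≥0∞),
      ∫⁻ x in Ω, ((fun x => ENNReal.ofReal (ρ x ^ (a / 2))) * k) x ^ (2 : ℝ) =
      ∫⁻ x in Ω, ENNReal.ofReal (ρ x ^ a) * k x ^ 2 := fun a k => by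
    refine setLIntegral_congr_fun hΩ.measurableSet fun x hx => ?_
    simp only [Pi.mul_apply]
    rw [ENNReal.rpow_two, mul_pow, hsq a x hx]
  have e2 : ∀ y : ℝ≥0∞, (y ^ (1 / (2 : ℝ))) ^ 2 = y := fun y => by
    rw [← ENNReal.rpow_natCast, ← ENNReal.rpow_mul]; norm_num
  have h2 := pow_le_pow_left' h1 2
  rw [mul_pow, e2, e2] at h2
  rw [e0]
  exact h2.trans_eq (congrArg₂ (· * ·) (e1 α f) (e1 γ g))

theorem weightedMass_eq_withDensity {A : Set (EuclideanSpace ℝ (Fin d))}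
    (hA : NullMeasurableSet A (volume.restrict Ω)) (ρ : EuclideanSpace ℝ (Fin d) → ℝ) (α : ℝ) :
    weightedMass Ω ρ α A =
      ((volume.restrict Ω).withDensity fun x => ENNReal.ofReal (ρ x ^ α)) A := by
  rw [weightedMass, withDensity_apply', Measure.restrict_restrict₀ hA]

/-- The distribution on `ℝ` of the values of `u` with respect to `ρ^α dx` on `Ω`. -/
noncomputable def massDistribution (Ω : Set (EuclideanSpace ℝ (Fin d)))
    (ρ : EuclideanSpace ℝ (Fin d) → ℝ) (α : ℝ) (u : EuclideanSpace ℝ (Fin d) → ℝ) : Measure ℝ :=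
  ((volume.restrict Ω).withDensity fun x => ENNReal.ofReal (ρ x ^ α)).map u

theorem massDistribution_apply (hu : AEMeasurable u (volume.restrict Ω))
    (ρ : EuclideanSpace ℝ (Fin d) → ℝ) (α : ℝ) {s : Set ℝ} (hs : MeasurableSet s) :
    massDistribution Ω ρ α u s = weightedMass Ω ρ α (u ⁻¹' s) := by
  rw [massDistribution, Measure.map_apply_of_aemeasurable
    (hu.mono_ac (withDensity_absolutelyContinuous _ _)) hs,
    weightedMass_eq_withDensity (hu.nullMeasurable hs)]

/-- On the small side of a cut, the perimeter controls the mass. -/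
theorem sweepCutSparsity_mul_le (hu : AEMeasurable u (volume.restrict Ω))
    (ρ : EuclideanSpace ℝ (Fin d) → ℝ) (α β : ℝ) [IsFiniteMeasure (massDistribution Ω ρ α u)]
    (t : ℝ) :
    sweepCutSparsity Ω ρ α β u *
      min (massDistribution Ω ρ α u (Ioi t)) (massDistribution Ω ρ α u (Iic t)) ≤
      weightedPerimeter Ω ρ β {x | t < u x} := by
  have e1 : massDistribution Ω ρ α u (Ioi t) = weightedMass Ω ρ α {x | t < u x} :=
    massDistribution_apply hu ρ α measurableSet_Ioi
  have e2 : massDistribution Ω ρ α u (Iic t) = weightedMass Ω ρ α {x | t < u x}ᶜ := by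
    rw [massDistribution_apply hu ρ α measurableSet_Iic]
    congr 1
    ext x
    simp
  have hfin : min (massDistribution Ω ρ α u (Ioi t)) (massDistribution Ω ρ α u (Iic t)) ≠ ⊤ :=
    ((min_le_left _ _).trans_lt (measure_lt_top _ _)).ne
  rw [e1, e2] at hfin ⊢
  -- A level with a null side is excluded from the infimum, but there the minimum is `0` and the
  -- bound is trivial.
  by_cases h1 : weightedMass Ω ρ α {x | t < u x} = 0
  · simp [h1]
  by_cases h2 : weightedMass Ω ρ α {x | t < u x}ᶜ = 0
  · simp [h2]
  have hle : sweepCutSparsity Ω ρ α β u ≤ cutSparsity Ω ρ α β {x | t < u x} :=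
    iInf_le_of_le t (iInf_le_of_le h1 (iInf_le _ h2))
  have hmin : min (weightedMass Ω ρ α {x | t < u x}) (weightedMass Ω ρ α {x | t < u x}ᶜ) ≠ 0 := by
    rcases min_choice (weightedMass Ω ρ α {x | t < u x}) (weightedMass Ω ρ α {x | t < u x}ᶜ)
      with h | h <;> rw [h] <;> assumption
  exact (ENNReal.le_div_iff_mul_le (Or.inl hmin) (Or.inl hfin)).1 hle

theorem lintegral_massDistribution (hΩ : IsOpen Ω) (hρ_pos : ∀ x ∈ Ω, 0 < ρ x)
    (hρ : ContinuousOn ρ Ω) (hu : AEMeasurable u (volume.restrict Ω)) (α m : ℝ) :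
    ∫⁻ s, ENNReal.ofReal ((s - m) ^ 2) ∂(massDistribution Ω ρ α u) =
      ∫⁻ x in Ω, ENNReal.ofReal (ρ x ^ α) * ‖u x - m‖ₑ ^ 2 := by
  rw [massDistribution, lintegral_map' (by fun_prop)
    (hu.mono_ac (withDensity_absolutelyContinuous _ _)),
    lintegral_withDensity_eq_lintegral_mul₀ (aemeasurable_ofReal_rpow hΩ hρ_pos hρ α) (by fun_prop)]
  refine lintegral_congr fun x => ?_
  simp only [Pi.mul_apply]
  rw [← ofReal_norm, ← ENNReal.ofReal_pow (norm_nonneg _), Real.norm_eq_abs, sq_abs]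

theorem HasWeakGradientOn.lintegral_variationMeasure (h : HasWeakGradientOn Ω u G)
    (hΩ : IsOpen Ω) (hρ_pos : ∀ x ∈ Ω, 0 < ρ x) (hρ : ContinuousOn ρ Ω) (β m : ℝ) :
    ∫⁻ s, ENNReal.ofReal (2 * |s - m|) ∂(variationMeasure Ω ρ β u G) =
      2 * ∫⁻ x in Ω, ENNReal.ofReal (ρ x ^ β) * ‖G x‖ₑ * ‖u x - m‖ₑ := by
  have hu := h.aemeasurable
  have hG : AEMeasurable (fun x => ‖G x‖ₑ) (volume.restrict Ω) :=
    h.locallyIntegrable_grad.aestronglyMeasurable.enorm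
  rw [variationMeasure, lintegral_map' (by fun_prop)
    (hu.mono_ac (withDensity_absolutelyContinuous _ _)),
    lintegral_withDensity_eq_lintegral_mul₀
      (f := fun x => ENNReal.ofReal (ρ x ^ β) * ‖G x‖ₑ)
      ((aemeasurable_ofReal_rpow hΩ hρ_pos hρ β).mul hG) (by fun_prop),
    ← lintegral_const_mul' _ _ (by simp)]
  refine lintegral_congr fun x => ?_
  simp only [Pi.mul_apply]
  rw [ENNReal.ofReal_mul zero_le_two, ← Real.norm_eq_abs, ofReal_norm]
  simp only [ENNReal.ofReal_ofNat]
  ring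

/-- The second moment of a mean zero function is minimal about `0`. -/
theorem lintegral_sq_le_lintegral_sq_sub (hΩ : IsOpen Ω) (hρ_pos : ∀ x ∈ Ω, 0 < ρ x)
    {α : ℝ} (hρ_int : IntegrableOn (fun x => ρ x ^ α) Ω volume)
    (hu : AEMeasurable u (volume.restrict Ω))
    (hfin : ∫⁻ x in Ω, ENNReal.ofReal (ρ x ^ α) * ‖u x‖ₑ ^ 2 ≠ ⊤)
    (hmean : ∫ x in Ω, ρ x ^ α * u x = 0) (m : ℝ) :
    ∫⁻ x in Ω, ENNReal.ofReal (ρ x ^ α) * ‖u x‖ₑ ^ 2 ≤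
        ∫⁻ x in Ω, ENNReal.ofReal (ρ x ^ α) * ‖u x - m‖ₑ ^ 2 ∧
      ∫⁻ x in Ω, ENNReal.ofReal (ρ x ^ α) * ‖u x - m‖ₑ ^ 2 ≠ ⊤ := by
  have hconv : ∀ k : ℝ, ∫⁻ x in Ω, ENNReal.ofReal (ρ x ^ α) * ‖u x - k‖ₑ ^ 2 =
      ∫⁻ x in Ω, ENNReal.ofReal (ρ x ^ α * (u x - k) ^ 2) := fun k => by
    refine setLIntegral_congr_fun hΩ.measurableSet fun x hx => ?_
    have := hρ_pos x hx
    rw [ENNReal.ofReal_mul (by positivity), ← ofReal_norm, ← ENNReal.ofReal_pow (norm_nonneg _),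
      Real.norm_eq_abs, sq_abs]
  have hm : AEMeasurable (fun x => ρ x ^ α) (volume.restrict Ω) :=
    hρ_int.aestronglyMeasurable.aemeasurable
  have hnn : ∀ k : ℝ, 0 ≤ᵐ[volume.restrict Ω] fun x => ρ x ^ α * (u x - k) ^ 2 := fun k => by
    filter_upwards [ae_restrict_mem hΩ.measurableSet] with x hx
    have := hρ_pos x hx
    simp only [Pi.zero_apply]
    positivity
  have h0 := hconv 0
  simp only [sub_zero] at h0
  have hi2 : Integrable (fun x => ρ x ^ α * u x ^ 2) (volume.restrict Ω) := by
    refine ⟨(hm.mul (hu.pow_const 2)).aestronglyMeasurable, ?_⟩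
    have := hnn 0
    simp only [sub_zero] at this
    rw [hasFiniteIntegral_iff_ofReal this, ← h0]
    exact hfin.lt_top
  have hi1 : Integrable (fun x => ρ x ^ α * u x) (volume.restrict Ω) := by
    refine (hρ_int.add hi2).mono' (hm.mul hu).aestronglyMeasurable ?_
    filter_upwards [ae_restrict_mem hΩ.measurableSet] with x hx
    have h1 : 0 ≤ ρ x ^ α := Real.rpow_nonneg (hρ_pos x hx).le _
    rw [Real.norm_eq_abs, abs_mul, abs_of_nonneg h1]
    -- Finite total mass and finite second moment thus give integrability of `ρ^α u`.
    have h2 : |u x| ≤ 1 + u x ^ 2 := by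
      rw [← sq_abs]; nlinarith [sq_nonneg (|u x| - 1), abs_nonneg (u x)]
    calc ρ x ^ α * |u x| ≤ ρ x ^ α * (1 + u x ^ 2) := mul_le_mul_of_nonneg_left h2 h1
      _ = _ := by simp only [Pi.add_apply]; ring
  -- After integration the cross term vanishes by `hmean`, leaving the extra `m² ∫ ρ^α ≥ 0`.
  have hexp : ∀ x, ρ x ^ α * (u x - m) ^ 2 =
      ρ x ^ α * u x ^ 2 - 2 * m * (ρ x ^ α * u x) + m ^ 2 * ρ x ^ α := fun x => by ring
  have him : Integrable (fun x => ρ x ^ α * (u x - m) ^ 2) (volume.restrict Ω) := by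
    simp only [hexp]
    exact (hi2.sub (hi1.const_mul _)).add (hρ_int.const_mul _)
  rw [hconv m, h0]
  have hnn0 := hnn 0
  simp only [sub_zero] at hnn0
  rw [← ofReal_integral_eq_lintegral_ofReal hi2 hnn0,
    ← ofReal_integral_eq_lintegral_ofReal him (hnn m)]
  refine ⟨ENNReal.ofReal_le_ofReal ?_, ENNReal.ofReal_ne_top⟩
  have e1 := integral_add (hi2.sub (hi1.const_mul (2 * m))) (hρ_int.const_mul (m ^ 2))
  have e2 := integral_sub hi2 (hi1.const_mul (2 * m))
  simp only [Pi.sub_apply] at e1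
  simp only [hexp]
  rw [e1, e2, integral_const_mul, integral_const_mul, hmean, mul_zero, sub_zero]
  have h3 : 0 ≤ ∫ x in Ω, ρ x ^ α := setIntegral_nonneg hΩ.measurableSet fun x hx =>
    Real.rpow_nonneg (hρ_pos x hx).le _
  have := mul_nonneg (sq_nonneg m) h3
  linarith

end WeakGradient

/-! ### Assembly of the Cheeger inequality -/

theorem mainTheorem3 {d : ℕ} (Ω : Set (EuclideanSpace ℝ (Fin d))) (hΩ : IsOpen Ω)
    (ρ : EuclideanSpace ℝ (Fin d) → ℝ) (hρ_pos : ∀ x ∈ Ω, 0 < ρ x)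
    (L : ℝ≥0) (hρ_lip : LipschitzOnWith L ρ Ω)
    (α β γ : ℝ) (hαβ : α = β - 1) (hαγ : α = γ - 2)
    (hρ_int : IntegrableOn (fun x => ρ x ^ α) Ω volume)
    (u : EuclideanSpace ℝ (Fin d) → ℝ) (hu : IsPrincipalEigenfunction Ω ρ α γ u) :
    sweepCutSparsity Ω ρ α β u ^ 2 ≤ 4 * principalEigenvalue Ω ρ α γ := by
  obtain ⟨G, hc, hR⟩ := hu
  have h := hc.weakGradient
  have hρ := hρ_lip.continuousOn
  -- The relation between the exponents enters only through this identity.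
  have hβ : β = α / 2 + γ / 2 := by linarith
  have hum := h.aemeasurable
  have hG : AEMeasurable (fun x => ‖G x‖ₑ) (volume.restrict Ω) :=
    h.locallyIntegrable_grad.aestronglyMeasurable.enorm
  have hmass : ∫⁻ x in Ω, ENNReal.ofReal (ρ x ^ α) ≠ ⊤ := hρ_int.lintegral_lt_top.ne
  have hPfin : IsFiniteMeasure (massDistribution Ω ρ α u) := by
    refine ⟨?_⟩
    rw [massDistribution_apply hum ρ α MeasurableSet.univ, weightedMass, preimage_univ, univ_inter]
    exact hmass.lt_top
  have hνfin : IsFiniteMeasure (variationMeasure Ω ρ β u G) := by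
    refine ⟨?_⟩
    rw [variationMeasure_apply h ρ β MeasurableSet.univ, preimage_univ, Measure.restrict_univ]
    -- Cauchy-Schwarz against the constant `1` bounds the total variation by mass and energy.
    have hCS := sq_lintegral_rpow_mul_le hΩ hρ_pos hρ hβ
      (aemeasurable_const (b := (1 : ℝ≥0∞))) hG
    simp only [one_pow, mul_one] at hCS
    have := hCS.trans_lt (ENNReal.mul_lt_top hmass.lt_top hc.energy_ne_top.lt_top)
    exact (ENNReal.pow_lt_top_iff.1 this).resolve_right two_ne_zero
  obtain ⟨m, hmr, hml⟩ := exists_median (massDistribution Ω ρ α u)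
  have hcoarea := h.ae_weightedPerimeter_le_rnDeriv hΩ ρ β
  have hΦ := mul_lintegral_sq_sub_le (massDistribution Ω ρ α u) (variationMeasure Ω ρ β u G) m
    (sweepCutSparsity Ω ρ α β u)
    (hcoarea.mono fun t ht hmt => by
      have := sweepCutSparsity_mul_le hum ρ α β t
      rw [min_eq_left (hmr t hmt)] at this
      exact this.trans ht)
    (hcoarea.mono fun t ht hmt => by
      have := sweepCutSparsity_mul_le hum ρ α β t
      rw [min_eq_right (hml t hmt)] at this
      exact this.trans ht)
  rw [lintegral_massDistribution hΩ hρ_pos hρ hum,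
    h.lintegral_variationMeasure hΩ hρ_pos hρ] at hΦ
  have hCS := sq_lintegral_rpow_mul_le hΩ hρ_pos hρ hβ (f := fun x => ‖u x - m‖ₑ)
    (by fun_prop) hG
  obtain ⟨hNI, hI⟩ := lintegral_sq_le_lintegral_sq_sub hΩ hρ_pos hρ_int hum hc.norm_ne_top
    hc.mean_zero m
  rw [← hR, rayleighQuotient, ← mul_div_assoc,
    ENNReal.le_div_iff_mul_le (Or.inl hc.norm_ne_zero) (Or.inl hc.norm_ne_top)]
  set I := ∫⁻ x in Ω, ENNReal.ofReal (ρ x ^ α) * ‖u x - m‖ₑ ^ 2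
  set Φ := sweepCutSparsity Ω ρ α β u
  have hI0 : I ≠ 0 := fun hI0 => hc.norm_ne_zero (le_zero_iff.1 (hI0 ▸ hNI))
  -- The second moment about `0` is enlarged to `I`; multiplying by `I`, positive and finite, then
  -- produces the square `(Φ I)²` and avoids square roots.
  refine (mul_le_mul_right hNI _).trans ?_
  refine (ENNReal.mul_le_mul_iff_right hI0 hI).1 ?_
  have h2 := pow_le_pow_left' hΦ 2
  rw [mul_pow 2] at h2
  calc I * (Φ ^ 2 * I) = (Φ * I) ^ 2 := by ring
    _ ≤ _ := h2.trans (mul_le_mul_right hCS _)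
    _ = _ := by ring
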